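/- Let $k,m\ge 1$ and identify $M_k(\mathbb{C})\otimes M_m(\mathbb{C})$ with $M_{km}(\mathbb{C})$ via the Kronecker product. The tensor rank of $A\in M_k\otimes M_m$ is the least $n$ such that $A$ is a sum of $n$ nonzero elementary tensors $C\otimes D$ with $C\in M_k$, $D\in M_m$. A separable decomposition of $A$ is an expression $A=\sum_{i=1}^n C_i\otimes D_i$ with all $C_i\in M_k$ and $D_i\in M_m$ positive semidefinite Hermitian; it is minimal if $C_1,\dots,C_n$ are linearly independent and $D_1,\dots,D_n$ are linearly independent. $A$ is separable if it has a separable decomposition. \textbf{Theorem (Minimal separability of tensor rank 2 matrices).} Let $A\in M_k\otimes M_m$ be a positive semidefinite Hermitian matrix of tensor rank $2$. Then $A$ has a minimal separable decomposition, and it has exactly two terms: $A=C_1\otimes D_1+C_2\otimes D_2$ with $C_1,C_2\in M_k$ and $D_1,D_2\in M_m$ positive semidefinite Hermitian, $C_1,C_2$ linearly independent and $D_1,D_2$ linearly independent. In particular, $A$ is separable. -/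

import Mathlib

open scoped TensorProduct Kronecker ComplexOrder

noncomputable section

/-- A tensor has tensor rank `1` if it is a nonzero pure tensor `v ⊗ w`. -/
def IsTensorRankOne {𝕜 V W : Type*} [Field 𝕜] [AddCommGroup V] [Module 𝕜 V]
    [AddCommGroup W] [Module 𝕜 W] (r : V ⊗[𝕜] W) : Prop :=
  r ≠ 0 ∧ ∃ (v : V) (w : W), r = v ⊗ₜ[𝕜] w

/-- The tensor rank of `r`: the minimal number of tensors of tensor rank `1` whose sum is `r`.
(The set of such numbers is never empty, and `tensorRank 0 = 0`.) -/
def tensorRank {𝕜 V W : Type*} [Field 𝕜] [AddCommGroup V] [Module 𝕜 V]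
    [AddCommGroup W] [Module 𝕜 W] (r : V ⊗[𝕜] W) : ℕ :=
  sInf {n : ℕ | ∃ t : Fin n → V ⊗[𝕜] W, (∀ i, IsTensorRankOne (t i)) ∧ r = ∑ i, t i}

/-- The tensor rank of `A ∈ M_k ⊗ M_m`, where `M_k ⊗ M_m` is identified with `M_{km}` via the
Kronecker product (`kroneckerLinearEquiv` sends `C ⊗ₜ D` to `C ⊗ₖ D`). -/
def matrixTensorRank {k m : ℕ} (A : Matrix (Fin k × Fin m) (Fin k × Fin m) ℂ) : ℕ :=
  tensorRank ((kroneckerLinearEquiv (Fin k) (Fin k) (Fin m) (Fin m) ℂ).symm A)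

/-- `A = ∑ i, C i ⊗ D i` is a decomposition of `A` in `M_k ⊗ M_m` with `n` terms. -/
def IsDecomposition {k m n : ℕ} (A : Matrix (Fin k × Fin m) (Fin k × Fin m) ℂ)
    (C : Fin n → Matrix (Fin k) (Fin k) ℂ) (D : Fin n → Matrix (Fin m) (Fin m) ℂ) : Prop :=
  A = ∑ i, C i ⊗ₖ D i

/-- A separable decomposition: all `C i` and `D i` are positive semidefinite Hermitian
(`Matrix.PosSemidef` includes Hermitian). -/
def IsSeparableDecomposition {k m n : ℕ} (A : Matrix (Fin k × Fin m) (Fin k × Fin m) ℂ)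
    (C : Fin n → Matrix (Fin k) (Fin k) ℂ) (D : Fin n → Matrix (Fin m) (Fin m) ℂ) : Prop :=
  IsDecomposition A C D ∧ ∀ i, (C i).PosSemidef ∧ (D i).PosSemidef

/-- A minimal decomposition: the `C i` are linearly independent and so are the `D i`. -/
def IsMinimalDecomposition {k m n : ℕ} (A : Matrix (Fin k × Fin m) (Fin k × Fin m) ℂ)
    (C : Fin n → Matrix (Fin k) (Fin k) ℂ) (D : Fin n → Matrix (Fin m) (Fin m) ℂ) : Prop :=
  IsDecomposition A C D ∧ LinearIndependent ℂ C ∧ LinearIndependent ℂ D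

/-- `A` is separable if it has a separable decomposition (with any finite number of terms). -/
def IsSeparableMatrix {k m : ℕ} (A : Matrix (Fin k × Fin m) (Fin k × Fin m) ℂ) : Prop :=
  ∃ (n : ℕ) (C : Fin n → Matrix (Fin k) (Fin k) ℂ) (D : Fin n → Matrix (Fin m) (Fin m) ℂ),
    IsSeparableDecomposition A C D

end

open Matrix
open scoped TensorProduct Kronecker ComplexOrder

/-! Compressing `A = a₁ ⊗ b₁ + a₂ ⊗ b₂` by a vector `w` in the right factor gives a positive
semidefinite element of the plane spanned by `a₁, a₂` (`posSemidef_partial_evaluation`). Two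
suitable vectors yield a positive semidefinite basis `X, Y` of that plane. The positive cone of its
real span has two extreme rays `C₁, C₂` (`exists_extreme_rays`). In this basis `A = C₁ ⊗ D₁ + C₂ ⊗
D₂`, and every compression has coordinates `⟨u, Dᵢ u⟩`, which are therefore nonnegative: the `Dᵢ`
are positive semidefinite. Minimality is automatic, since a dependent two-term sum would collapse to
one term. -/

theorem exists_tensor_sum_of_tensorRank {𝕜 V W : Type*} [Field 𝕜] [AddCommGroup V] [Module 𝕜 V]
    [AddCommGroup W] [Module 𝕜 W] {r : V ⊗[𝕜] W} {n : ℕ} (hn : n ≠ 0) (h : tensorRank r = n) :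
    ∃ (v : Fin n → V) (w : Fin n → W), r = ∑ i, v i ⊗ₜ[𝕜] w i := by
  -- As `sInf ∅ = 0`, a nonzero rank forces the set to be nonempty, so the infimum is attained.
  have hmem := Nat.sInf_mem (Nat.nonempty_of_pos_sInf (s := {n : ℕ | ∃ t : Fin n → V ⊗[𝕜] W,
    (∀ i, IsTensorRankOne (t i)) ∧ r = ∑ i, t i}) (by
      change 0 < tensorRank r
      omega))
  change tensorRank r ∈ _ at hmem
  rw [h] at hmem
  obtain ⟨t, ht, hr⟩ := hmem
  choose v w hvw using fun i => (ht i).2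
  exact ⟨v, w, by rw [hr]; exact Finset.sum_congr rfl fun i _ => hvw i⟩

theorem tensorRank_tmul_le_one {𝕜 V W : Type*} [Field 𝕜] [AddCommGroup V] [Module 𝕜 V]
    [AddCommGroup W] [Module 𝕜 W] (v : V) (w : W) : tensorRank (v ⊗ₜ[𝕜] w) ≤ 1 := by
  by_cases h : v ⊗ₜ[𝕜] w = 0
  · exact (Nat.sInf_le ⟨fun _ => 0, fun i => i.elim0, by simp [h]⟩ :
      tensorRank (v ⊗ₜ[𝕜] w) ≤ 0).trans zero_le_one
  · exact Nat.sInf_le ⟨fun _ => v ⊗ₜ[𝕜] w, fun _ => ⟨h, v, w, rfl⟩, by simp⟩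

section

variable {k m : ℕ} {A : Matrix (Fin k × Fin m) (Fin k × Fin m) ℂ}

theorem exists_kronecker_sum_of_matrixTensorRank_eq_two (h : matrixTensorRank A = 2) :
    ∃ (a₁ a₂ : Matrix (Fin k) (Fin k) ℂ) (b₁ b₂ : Matrix (Fin m) (Fin m) ℂ),
      A = a₁ ⊗ₖ b₁ + a₂ ⊗ₖ b₂ := by
  obtain ⟨v, w, hvw⟩ := exists_tensor_sum_of_tensorRank two_ne_zero h
  rw [LinearEquiv.symm_apply_eq] at hvw
  exact ⟨v 0, v 1, w 0, w 1, by simpa [Fin.sum_univ_two] using hvw⟩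

theorem ne_kronecker_of_matrixTensorRank_eq_two (h : matrixTensorRank A = 2)
    (C : Matrix (Fin k) (Fin k) ℂ) (D : Matrix (Fin m) (Fin m) ℂ) : A ≠ C ⊗ₖ D := by
  rintro rfl
  rw [matrixTensorRank, kroneckerLinearEquiv_symm_kronecker] at h
  have := tensorRank_tmul_le_one (𝕜 := ℂ) C D
  omega

theorem linearIndependent_left_of_matrixTensorRank_eq_two (h : matrixTensorRank A = 2)
    {a₁ a₂ : Matrix (Fin k) (Fin k) ℂ} {b₁ b₂ : Matrix (Fin m) (Fin m) ℂ}
    (hA : A = a₁ ⊗ₖ b₁ + a₂ ⊗ₖ b₂) : LinearIndependent ℂ ![a₁, a₂] := by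
  rw [linearIndependent_fin2]
  refine ⟨fun h0 => ?_, fun c hc => ?_⟩
  · apply ne_kronecker_of_matrixTensorRank_eq_two h a₁ b₁
    simp only [cons_val_one, cons_val_fin_one] at h0
    rw [hA, h0, zero_kronecker, add_zero]
  · apply ne_kronecker_of_matrixTensorRank_eq_two h a₂ (c • b₁ + b₂)
    simp only [cons_val_one, cons_val_zero, cons_val_fin_one] at hc
    rw [hA, ← hc, kronecker_add, smul_kronecker, kronecker_smul]

theorem linearIndependent_right_of_matrixTensorRank_eq_two (h : matrixTensorRank A = 2)
    {a₁ a₂ : Matrix (Fin k) (Fin k) ℂ} {b₁ b₂ : Matrix (Fin m) (Fin m) ℂ}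
    (hA : A = a₁ ⊗ₖ b₁ + a₂ ⊗ₖ b₂) : LinearIndependent ℂ ![b₁, b₂] := by
  rw [linearIndependent_fin2]
  refine ⟨fun h0 => ?_, fun c hc => ?_⟩
  · apply ne_kronecker_of_matrixTensorRank_eq_two h a₁ b₁
    simp only [cons_val_one, cons_val_fin_one] at h0
    rw [hA, h0, kronecker_zero, add_zero]
  · apply ne_kronecker_of_matrixTensorRank_eq_two h (c • a₁ + a₂) b₂
    simp only [cons_val_one, cons_val_zero, cons_val_fin_one] at hc
    rw [hA, ← hc, add_kronecker, smul_kronecker, kronecker_smul]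

end

theorem kronecker_add_kronecker_change_basis {p q : Type*} (a₁ a₂ : Matrix p p ℂ)
    (b₁ b₂ : Matrix q q ℂ) {α β γ δ : ℂ} (h : α * δ - β * γ ≠ 0) :
    a₁ ⊗ₖ b₁ + a₂ ⊗ₖ b₂ =
      (α • a₁ + β • a₂) ⊗ₖ ((α * δ - β * γ)⁻¹ • (δ • b₁ - γ • b₂)) +
      (γ • a₁ + δ • a₂) ⊗ₖ ((α * δ - β * γ)⁻¹ • (α • b₂ - β • b₁)) := by
  ext i j
  simp only [Matrix.add_apply, kroneckerMap_apply, Matrix.smul_apply, Matrix.sub_apply, smul_eq_mul]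
  field_simp
  ring

/-- The left factor of `A` obtained by evaluating the right factor at a vector. -/
theorem posSemidef_partial_evaluation {p q : Type*} [Fintype p] [DecidableEq p] [Fintype q]
    {a₁ a₂ : Matrix p p ℂ} {b₁ b₂ : Matrix q q ℂ}
    (h : (a₁ ⊗ₖ b₁ + a₂ ⊗ₖ b₂).PosSemidef) (w : q → ℂ) :
    ((star w ⬝ᵥ b₁ *ᵥ w) • a₁ + (star w ⬝ᵥ b₂ *ᵥ w) • a₂).PosSemidef := by
  have key (a : Matrix p p ℂ) (b : Matrix q q ℂ) :
      (((1 : Matrix p p ℂ) ⊗ₖ replicateCol Unit w)ᴴ * (a ⊗ₖ b) *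
        ((1 : Matrix p p ℂ) ⊗ₖ replicateCol Unit w)).submatrix (fun i => (i, ())) (fun i => (i, ()))
        = (star w ⬝ᵥ b *ᵥ w) • a := by
    rw [conjTranspose_kronecker, ← mul_kronecker_mul, ← mul_kronecker_mul, conjTranspose_one,
      one_mul, mul_one, Matrix.mul_assoc]
    ext i j
    simp only [submatrix_apply, kroneckerMap_apply, Matrix.smul_apply, smul_eq_mul]
    rw [mul_comm]
    rfl
  have := (h.conjTranspose_mul_mul_same
    ((1 : Matrix p p ℂ) ⊗ₖ replicateCol Unit w)).submatrix (fun i => (i, ()))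
  rw [Matrix.mul_add, Matrix.add_mul] at this
  rw [← key, ← key]
  exact this

theorem exists_star_dotProduct_mulVec_ne_zero {q : Type*} [Fintype q] [DecidableEq q]
    {M : Matrix q q ℂ} (hM : M ≠ 0) : ∃ w : q → ℂ, star w ⬝ᵥ M *ᵥ w ≠ 0 := by
  by_contra! h
  apply hM
  have h2 : toEuclideanLin M = 0 := by
    rw [← inner_map_self_eq_zero]
    intro x
    rw [← inner_conj_symm, EuclideanSpace.inner_eq_star_dotProduct, toEuclideanLin, ofLp_toLpLin,
      toLin'_apply, dotProduct_comm, h, map_zero]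
  simpa using h2

theorem exists_det_evaluation_ne_zero {q : Type*} [Fintype q] [DecidableEq q]
    {b₁ b₂ : Matrix q q ℂ} (h : LinearIndependent ℂ ![b₁, b₂]) :
    ∃ v w : q → ℂ, (star v ⬝ᵥ b₁ *ᵥ v) * (star w ⬝ᵥ b₂ *ᵥ w) -
      (star v ⬝ᵥ b₂ *ᵥ v) * (star w ⬝ᵥ b₁ *ᵥ w) ≠ 0 := by
  rw [LinearIndependent.pair_iff] at h
  obtain ⟨v, hv⟩ := exists_star_dotProduct_mulVec_ne_zero (M := b₁) fun h0 =>
    one_ne_zero (h 1 0 (by simp [h0])).1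
  -- With `v` fixed, the determinant is the quadratic form of this combination at `w`; independence
  -- keeps the combination nonzero.
  obtain ⟨w, hw⟩ := exists_star_dotProduct_mulVec_ne_zero
    (M := (-(star v ⬝ᵥ b₂ *ᵥ v)) • b₁ + (star v ⬝ᵥ b₁ *ᵥ v) • b₂) fun h0 => hv (h _ _ h0).2
  refine ⟨v, w, fun h0 => hw ?_⟩
  rw [add_mulVec, dotProduct_add, smul_mulVec, smul_mulVec, dotProduct_smul, dotProduct_smul,
    smul_eq_mul, smul_eq_mul]
  linear_combination h0

/-! ### The positive semidefinite cone in a plane -/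

section Cone

variable {p : Type*}

theorem Matrix.PosSemidef.real_smul {X : Matrix p p ℂ} (hX : X.PosSemidef) {c : ℝ} (hc : 0 ≤ c) :
    ((c : ℂ) • X).PosSemidef :=
  hX.smul (by exact_mod_cast hc)

/-- If `x < 0`, adding a multiple of `D` makes its coefficient positive; rescaling then gives `D - ε
C` in the cone with `ε > 0`. -/
theorem nonneg_of_posSemidef_smul_add_smul {C D : Matrix p p ℂ} (hD : D.PosSemidef)
    (h : ∀ ε : ℝ, (D - (ε : ℂ) • C).PosSemidef → ε ≤ 0) {x y : ℝ}
    (hxy : ((x : ℂ) • C + (y : ℂ) • D).PosSemidef) : 0 ≤ x := by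
  have hz : 0 < y + (|y| + 1) := by linarith [neg_abs_le y]
  have h1 := (hxy.add (hD.real_smul (c := |y| + 1) (by positivity))).real_smul (inv_nonneg.2 hz.le)
  have h2 := h (-(x / (y + (|y| + 1)))) (by
    convert h1 using 1
    have : (y : ℂ) + ((|y| : ℝ) + 1) ≠ 0 := by exact_mod_cast hz.ne'
    ext i j
    simp only [Matrix.add_apply, Matrix.smul_apply, Matrix.sub_apply, smul_eq_mul]
    push_cast
    field_simp
    ring)
  have h3 : 0 ≤ x / (y + (|y| + 1)) := by linarith
  rwa [le_div_iff₀ hz, zero_mul] at h3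

/-- The matrix in `h` is `(1 + ε r) X - (s + ε) Y`, so maximality of `s` gives `ε (1 - s r) ≤ 0`
whenever `ε > 0`. -/
theorem nonpos_of_posSemidef_sub_smul {X Y : Matrix p p ℂ} {s r : ℝ} (hr : 0 ≤ r) (hsr : s * r < 1)
    (hs : ∀ t : ℝ, (X - (t : ℂ) • Y).PosSemidef → t ≤ s) {ε : ℝ}
    (h : (X - (s : ℂ) • Y - (ε : ℂ) • (Y - (r : ℂ) • X)).PosSemidef) : ε ≤ 0 := by
  by_contra! hε
  have hz : 0 < 1 + ε * r := by positivity
  have h1 := hs ((s + ε) / (1 + ε * r)) (by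
    convert h.real_smul (inv_nonneg.2 hz.le) using 1
    have : (1 : ℂ) + ε * r ≠ 0 := by exact_mod_cast hz.ne'
    ext i j
    simp only [Matrix.smul_apply, Matrix.sub_apply, smul_eq_mul]
    push_cast
    field_simp
    ring)
  rw [div_le_iff₀ hz] at h1
  nlinarith

variable [Fintype p]

theorem Matrix.PosSemidef.trace_re_nonneg {X : Matrix p p ℂ} (hX : X.PosSemidef) :
    0 ≤ X.trace.re := (Complex.le_def.1 hX.trace_nonneg).1

theorem Matrix.PosSemidef.trace_re_pos {X : Matrix p p ℂ} (hX : X.PosSemidef) (h : X ≠ 0) :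
    0 < X.trace.re := by
  refine lt_of_le_of_ne hX.trace_re_nonneg fun h0 => h ?_
  rw [← hX.trace_eq_zero_iff]
  exact Complex.ext h0.symm (Complex.le_def.1 hX.trace_nonneg).2.symm

theorem isClosed_setOf_posSemidef_sub_smul {X Y : Matrix p p ℂ} (hX : X.IsHermitian)
    (hY : Y.IsHermitian) : IsClosed {t : ℝ | (X - (t : ℂ) • Y).PosSemidef} := by
  have hH (t : ℝ) : (X - (t : ℂ) • Y).IsHermitian := by
    rw [IsHermitian, conjTranspose_sub, conjTranspose_smul, hX.eq, hY.eq]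
    simp
  simp only [posSemidef_iff_dotProduct_mulVec, hH, true_and, Set.ofPred_forall]
  refine isClosed_iInter fun x => isClosed_le continuous_const ?_
  simp only [sub_mulVec, smul_mulVec, dotProduct_sub, dotProduct_smul, smul_eq_mul]
  fun_prop

theorem exists_max_posSemidef_sub_smul {X Y : Matrix p p ℂ} (hX : X.PosSemidef)
    (hY : Y.PosSemidef) (hY0 : Y ≠ 0) :
    ∃ s : ℝ, 0 ≤ s ∧ (X - (s : ℂ) • Y).PosSemidef ∧
      ∀ t : ℝ, (X - (t : ℂ) • Y).PosSemidef → t ≤ s := by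
  have h0 : (0 : ℝ) ∈ {t : ℝ | (X - (t : ℂ) • Y).PosSemidef} := by simpa using hX
  have hb : BddAbove {t : ℝ | (X - (t : ℂ) • Y).PosSemidef} := by
    -- The trace of `X - t Y` is nonnegative.
    refine ⟨X.trace.re / Y.trace.re, fun t ht => ?_⟩
    rw [le_div_iff₀ (hY.trace_re_pos hY0)]
    simpa using Matrix.PosSemidef.trace_re_nonneg ht
  exact ⟨_, le_csSup hb h0,
    (isClosed_setOf_posSemidef_sub_smul hX.isHermitian hY.isHermitian).csSup_mem ⟨0, h0⟩ hb,
    fun t ht => le_csSup hb ht⟩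

/-- The cone of positive semidefinite matrices in a plane spanned by two of them is generated by
two extreme rays. -/
theorem exists_extreme_rays {X Y : Matrix p p ℂ} (hX : X.PosSemidef) (hY : Y.PosSemidef)
    (h : LinearIndependent ℂ ![X, Y]) :
    ∃ s r : ℝ, s * r < 1 ∧ (X - (s : ℂ) • Y).PosSemidef ∧ (Y - (r : ℂ) • X).PosSemidef ∧
      ∀ x y : ℝ, ((x : ℂ) • (X - (s : ℂ) • Y) + (y : ℂ) • (Y - (r : ℂ) • X)).PosSemidef →
        0 ≤ x ∧ 0 ≤ y := by
  rw [LinearIndependent.pair_iff] at h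
  have hX0 : X ≠ 0 := fun h0 => one_ne_zero (h 1 0 (by simp [h0])).1
  have hY0 : Y ≠ 0 := fun h0 => one_ne_zero (h 0 1 (by simp [h0])).2
  obtain ⟨s, hs, hC, hsmax⟩ := exists_max_posSemidef_sub_smul hX hY hY0
  obtain ⟨r, hr, hD, hrmax⟩ := exists_max_posSemidef_sub_smul hY hX hX0
  have hC0 : X - (s : ℂ) • Y ≠ 0 := fun h0 => one_ne_zero (h 1 (-s) (by
    rw [one_smul, neg_smul, ← sub_eq_add_neg, h0])).1
  -- Traces give `tr X > s tr Y ≥ s r tr X`.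
  have hsr : s * r < 1 := by
    have h1 := hC.trace_re_pos hC0
    have h2 := mul_nonneg hs hD.trace_re_nonneg
    have h3 := hX.trace_re_pos hX0
    simp only [trace_sub, trace_smul, smul_eq_mul, Complex.sub_re, Complex.re_ofReal_mul] at h1 h2
    by_contra! h4
    nlinarith
  refine ⟨s, r, hsr, hC, hD, fun x y hxy => ⟨?_, ?_⟩⟩
  · exact nonneg_of_posSemidef_smul_add_smul hD
      (fun ε => nonpos_of_posSemidef_sub_smul hs (by linarith) hrmax) hxy
  · rw [add_comm] at hxy
    exact nonneg_of_posSemidef_smul_add_smul hC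
      (fun ε => nonpos_of_posSemidef_sub_smul hr hsr hsmax) hxy

end Cone

/-- Each `(i, j)` block of the sum minus its adjoint is a combination of `C₁, C₂`, so its
coefficients vanish. -/
theorem isHermitian_right_of_kronecker {p q : Type*} {C₁ C₂ : Matrix p p ℂ} {D₁ D₂ : Matrix q q ℂ}
    (h : (C₁ ⊗ₖ D₁ + C₂ ⊗ₖ D₂).IsHermitian) (h₁ : C₁.IsHermitian) (h₂ : C₂.IsHermitian)
    (hC : LinearIndependent ℂ ![C₁, C₂]) : D₁.IsHermitian ∧ D₂.IsHermitian := by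
  rw [LinearIndependent.pair_iff] at hC
  rw [IsHermitian, conjTranspose_add, conjTranspose_kronecker, conjTranspose_kronecker, h₁.eq,
    h₂.eq] at h
  have key (i j : q) := hC (D₁ᴴ i j - D₁ i j) (D₂ᴴ i j - D₂ i j) (by
    ext a b
    have := congr_fun (congr_fun h (a, i)) (b, j)
    simp only [Matrix.add_apply, kroneckerMap_apply] at this
    simp only [Matrix.add_apply, Matrix.smul_apply, smul_eq_mul, Matrix.zero_apply]
    linear_combination this)
  exact ⟨Matrix.ext fun i j => sub_eq_zero.1 (key i j).1,
    Matrix.ext fun i j => sub_eq_zero.1 (key i j).2⟩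

theorem exists_posSemidef_kronecker_sum {k m : ℕ}
    {A : Matrix (Fin k × Fin m) (Fin k × Fin m) ℂ} (hA : A.PosSemidef)
    (hrank : matrixTensorRank A = 2) :
    ∃ (C₁ C₂ : Matrix (Fin k) (Fin k) ℂ) (D₁ D₂ : Matrix (Fin m) (Fin m) ℂ),
      A = C₁ ⊗ₖ D₁ + C₂ ⊗ₖ D₂ ∧
      C₁.PosSemidef ∧ C₂.PosSemidef ∧ D₁.PosSemidef ∧ D₂.PosSemidef := by
  obtain ⟨a₁, a₂, b₁, b₂, hab⟩ := exists_kronecker_sum_of_matrixTensorRank_eq_two hrank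
  obtain ⟨v, w, hvw⟩ := exists_det_evaluation_ne_zero
    (linearIndependent_right_of_matrixTensorRank_eq_two hrank hab)
  have hX := posSemidef_partial_evaluation (hab ▸ hA) v
  have hY := posSemidef_partial_evaluation (hab ▸ hA) w
  rw [kronecker_add_kronecker_change_basis a₁ a₂ b₁ b₂ hvw] at hab
  generalize (star v ⬝ᵥ b₁ *ᵥ v) • a₁ + (star v ⬝ᵥ b₂ *ᵥ v) • a₂ = X at hX hab
  generalize (star w ⬝ᵥ b₁ *ᵥ w) • a₁ + (star w ⬝ᵥ b₂ *ᵥ w) • a₂ = Y at hY hab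
  obtain ⟨s, r, hsr, hC₁, hC₂, hcone⟩ := exists_extreme_rays hX hY
    (linearIndependent_left_of_matrixTensorRank_eq_two hrank hab)
  have hdet : (1 : ℂ) * 1 - (-s) * (-r) ≠ 0 := by
    have : 1 * 1 - (-s) * (-r) ≠ 0 := by nlinarith
    exact_mod_cast this
  rw [kronecker_add_kronecker_change_basis X Y _ _ hdet,
    show (1 : ℂ) • X + (-s : ℂ) • Y = X - (s : ℂ) • Y by simp [sub_eq_add_neg],
    show (-r : ℂ) • X + (1 : ℂ) • Y = Y - (r : ℂ) • X by simp [neg_add_eq_sub]] at hab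
  generalize X - (s : ℂ) • Y = C₁ at hC₁ hcone hab
  generalize Y - (r : ℂ) • X = C₂ at hC₂ hcone hab
  generalize (((1 : ℂ) * 1 - (-s) * (-r))⁻¹ • _ : Matrix (Fin m) (Fin m) ℂ) = D₁ at hab
  generalize (((1 : ℂ) * 1 - (-s) * (-r))⁻¹ • _ : Matrix (Fin m) (Fin m) ℂ) = D₂ at hab
  obtain ⟨hD₁, hD₂⟩ := isHermitian_right_of_kronecker (hab ▸ hA.isHermitian) hC₁.isHermitian
    hC₂.isHermitian (linearIndependent_left_of_matrixTensorRank_eq_two hrank hab)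
  have key (u : Fin m → ℂ) : 0 ≤ star u ⬝ᵥ D₁ *ᵥ u ∧ 0 ≤ star u ⬝ᵥ D₂ *ᵥ u := by
    have hu := posSemidef_partial_evaluation (hab ▸ hA) u
    -- `hcone` needs real coordinates; hermiticity of the `Dᵢ` provides them.
    have e₁ : ((star u ⬝ᵥ D₁ *ᵥ u).re : ℂ) = star u ⬝ᵥ D₁ *ᵥ u :=
      Complex.ext rfl (hD₁.im_star_dotProduct_mulVec_self u).symm
    have e₂ : ((star u ⬝ᵥ D₂ *ᵥ u).re : ℂ) = star u ⬝ᵥ D₂ *ᵥ u :=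
      Complex.ext rfl (hD₂.im_star_dotProduct_mulVec_self u).symm
    rw [← e₁, ← e₂] at hu ⊢
    exact_mod_cast hcone _ _ hu
  exact ⟨C₁, C₂, D₁, D₂, hab, hC₁, hC₂, .of_dotProduct_mulVec_nonneg hD₁ fun u => (key u).1,
    .of_dotProduct_mulVec_nonneg hD₂ fun u => (key u).2⟩

theorem mainTheorem5 (k m : ℕ) (A : Matrix (Fin k × Fin m) (Fin k × Fin m) ℂ)
    (hA : A.PosSemidef) (hrank : matrixTensorRank A = 2) :
    (∃ (C : Fin 2 → Matrix (Fin k) (Fin k) ℂ) (D : Fin 2 → Matrix (Fin m) (Fin m) ℂ),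
      IsSeparableDecomposition A C D ∧ IsMinimalDecomposition A C D) ∧
    IsSeparableMatrix A := by
  obtain ⟨C₁, C₂, D₁, D₂, hdec, hC₁, hC₂, hD₁, hD₂⟩ := exists_posSemidef_kronecker_sum hA hrank
  have hd : IsDecomposition A ![C₁, C₂] ![D₁, D₂] := by
    simpa [IsDecomposition, Fin.sum_univ_two] using hdec
  have hs : IsSeparableDecomposition A ![C₁, C₂] ![D₁, D₂] :=
    ⟨hd, by simp [Fin.forall_fin_two, *]⟩
  exact ⟨⟨_, _, hs, hd, linearIndependent_left_of_matrixTensorRank_eq_two hrank hdec,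
    linearIndependent_right_of_matrixTensorRank_eq_two hrank hdec⟩, _, _, _, hs⟩
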